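/- Let $n\ge 1$, let $F_n$ be the free group on $n$ generators, $\Phi_n=F_n/F_n''$ the free metabelian group with free generators $y_1,\dots,y_n$, and $IA(\Phi_n)=\ker(\mathrm{Aut}(\Phi_n)\to \mathrm{Aut}(\Phi_n/\Phi_n'))$. Automorphisms are composed from left to right, i.e. $\alpha\beta$ means first $\alpha$, then $\beta$. Let $R_n=\mathbb{Z}[\mathbb{Z}^n]=\mathbb{Z}[x_1^{\pm1},\dots,x_n^{\pm1}]$, and for a commutative ring $R$ and an ideal $H$ put $GL_d(R,H)=\ker(GL_d(R)\to GL_d(R/H))$. Let $\mu$ be the Magnus homomorphism from $\Phi_n$ to the group of matrices $\begin{pmatrix} g & a_1t_1+\dots+a_nt_n\\ 0&1\end{pmatrix}$ ($g\in\mathbb{Z}^n$ a monomial in the $x_k$, $a_l\in R_n$, and $t_1,\dots,t_n$ a basis of a free $R_n$-module) given by $\mu(y_k)=\begin{pmatrix} x_k & t_k\\ 0&1\end{pmatrix}$. For $\alpha\in IA(\Phi_n)$ let $J(\alpha)=(a_{k,l})$ be its Magnus matrix, defined by $\mu(\alpha(y_k))=\begin{pmatrix} x_k & a_{k,1}t_1+\dots+a_{k,n}t_n\\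 0&1\end{pmatrix}$. Let $1\le i\le n$ and $\Gamma_i=GL_{n-1}\bigl(\mathbb{Z}[x_i^{\pm1}],(x_i-1)\mathbb{Z}[x_i^{\pm1}]\bigr)$. Then: 1. There is a surjective group homomorphism $\rho_i: IA(\Phi_n)\to\Gamma_i$ that sends $\alpha$ to the matrix obtained from $J(\alpha)$ by deleting the $i$-th row and the $i$-th column and setting $x_j=1$ for all $j\ne i$. 2. There is an injective group homomorphism $\iota_i:\Gamma_i\to IA(\Phi_n)$ such that, for every $M\in\Gamma_i$, the $i$-th row of $J(\iota_i(M))$ is the $i$-th row of the identity matrix, and deleting the $i$-th row and the $i$-th column of $J(\iota_i(M))$ leaves $M$ (viewed over $R_n\supseteq\mathbb{Z}[x_i^{\pm1}]$). 3. $\rho_i\circ\iota_i=\mathrm{id}_{\Gamma_i}$. 4. Hence $IA(\Phi_n)=\ker\rho_i\rtimes\Gamma_i$, where $\Gamma_i$ acts on $\ker\rho_i$ by conjugation through $\iota_i$: the map $(k,M)\mapsto k\,\iota_i(M)$ is an isomorphism from the semidirect product $\ker\rho_i\rtimes\Gamma_i$ onto $IA(\Phi_n)$. -/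

import Mathlib

/-- The free metabelian group `F_n / F_n''` of rank `n`. -/
abbrev FreeMetabelian (n : ℕ) : Type :=
  FreeGroup (Fin n) ⧸ derivedSeries (FreeGroup (Fin n)) 2

/-- The `k`-th free generator of the free metabelian group. -/
def FreeMetabelian.gen {n : ℕ} (k : Fin n) : FreeMetabelian n :=
  QuotientGroup.mk (FreeGroup.of k)

/-- The natural homomorphism `Aut(G) → Aut(G / G')`. -/
def autToAutAbelianization (G : Type*) [Group G] :
    MulAut G →* MulAut (Abelianization G) where
  toFun α := MulEquiv.abelianizationCongr α
  map_one' := abelianizationCongr_refl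
  map_mul' α β := (abelianizationCongr_trans β α).symm

/-- `IA(Φ_n) = ker (Aut(Φ_n) → Aut(Φ_n / Φ_n'))`, where `Φ_n` is the free metabelian group. -/
def IA (n : ℕ) : Subgroup (MulAut (FreeMetabelian n)) :=
  (autToAutAbelianization (FreeMetabelian n)).ker

/-- The ring `R_n = ℤ[ℤ^n] = ℤ[x_1^{±1}, …, x_n^{±1}]`;
the monomial `x^g` is `AddMonoidAlgebra.single g 1`. -/
abbrev LaurentRing (n : ℕ) : Type := AddMonoidAlgebra ℤ (Fin n → ℤ)

/-- The projection `R_n → ℤ[x_i^{±1}]` with `x_i ↦ x_i` and `x_j ↦ 1` for `j ≠ i`. -/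
noncomputable def projLaurent {n : ℕ} (i : Fin n) : LaurentRing n →+* LaurentPolynomial ℤ :=
  AddMonoidAlgebra.mapDomainRingHom ℤ (Pi.evalAddMonoidHom (fun _ : Fin n => ℤ) i)

/-- The inclusion `ℤ[x_i^{±1}] → R_n` with `x_i ↦ x_i`. -/
noncomputable def inclLaurent {n : ℕ} (i : Fin n) : LaurentPolynomial ℤ →+* LaurentRing n :=
  AddMonoidAlgebra.mapDomainRingHom ℤ (AddMonoidHom.single (fun _ : Fin n => ℤ) i)

/-- The group of formal matrices `(x^g, a_1 t_1 + … + a_n t_n; 0, 1)` with `g ∈ ℤ^n` and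
`a_1, …, a_n ∈ R_n`, where `t_1, …, t_n` is a basis of a free `R_n`-module. -/
@[ext] structure MagnusGroup (n : ℕ) where
  /-- the exponent `g` of the upper left entry -/
  exponent : Fin n → ℤ
  /-- the coefficients `a_1, …, a_n` of the upper right entry -/
  coeff : Fin n → LaurentRing n

namespace MagnusGroup

variable {n : ℕ}

noncomputable instance : One (MagnusGroup n) := ⟨⟨0, 0⟩⟩

/-- Matrix multiplication: `(x^g, a; 0, 1) (x^h, b; 0, 1) = (x^(g+h), a + x^g b; 0, 1)`. -/
noncomputable instance : Mul (MagnusGroup n) :=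
  ⟨fun A B => ⟨A.exponent + B.exponent,
    A.coeff + (AddMonoidAlgebra.single A.exponent 1 : LaurentRing n) • B.coeff⟩⟩

noncomputable instance : Inv (MagnusGroup n) :=
  ⟨fun A => ⟨-A.exponent,
    -((AddMonoidAlgebra.single (-A.exponent) 1 : LaurentRing n) • A.coeff)⟩⟩

@[simp] theorem one_exponent : (1 : MagnusGroup n).exponent = 0 := rfl
@[simp] theorem one_coeff : (1 : MagnusGroup n).coeff = 0 := rfl
@[simp] theorem mul_exponent (A B : MagnusGroup n) :
    (A * B).exponent = A.exponent + B.exponent := rfl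
@[simp] theorem mul_coeff (A B : MagnusGroup n) :
    (A * B).coeff =
      A.coeff + (AddMonoidAlgebra.single A.exponent 1 : LaurentRing n) • B.coeff := rfl
@[simp] theorem inv_exponent (A : MagnusGroup n) : (A⁻¹).exponent = -A.exponent := rfl
@[simp] theorem inv_coeff (A : MagnusGroup n) :
    (A⁻¹).coeff =
      -((AddMonoidAlgebra.single (-A.exponent) 1 : LaurentRing n) • A.coeff) := rfl

noncomputable instance : Group (MagnusGroup n) :=
  Group.ofLeftAxioms
    (fun A B C => by
      ext1
      · simp [add_assoc]
      · simp only [mul_coeff, mul_exponent, smul_add, smul_smul,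
          AddMonoidAlgebra.single_mul_single, mul_one, add_assoc])
    (fun A => by
      ext1
      · simp
      · simp [← AddMonoidAlgebra.one_def])
    (fun A => by
      ext1
      · simp
      · simp)

/-- The projection of the Magnus group onto `ℤ^n`. -/
noncomputable def exponentHom (n : ℕ) : MagnusGroup n →* Multiplicative (Fin n → ℤ) where
  toFun A := Multiplicative.ofAdd A.exponent
  map_one' := rfl
  map_mul' _ _ := rfl

theorem derivedSeries_two (n : ℕ) : derivedSeries (MagnusGroup n) 2 = ⊥ := by
  have h1 : derivedSeries (MagnusGroup n) 1 ≤ (exponentHom n).ker := by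
    rw [derivedSeries_one]
    exact Abelianization.commutator_subset_ker _
  rw [derivedSeries_succ, eq_bot_iff, Subgroup.commutator_le]
  intro A hA B hB
  have hA' : A.exponent = 0 := h1 hA
  have hB' : B.exponent = 0 := h1 hB
  rw [Subgroup.mem_bot, commutatorElement_eq_one_iff_mul_comm]
  ext1
  · simp [hA', hB']
  · simp [hA', hB', ← AddMonoidAlgebra.one_def, add_comm]

end MagnusGroup

/-- The Magnus homomorphism on the free group: `x_k ↦ (x_k, t_k; 0, 1)`. -/
noncomputable def magnusFree (n : ℕ) : FreeGroup (Fin n) →* MagnusGroup n :=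
  FreeGroup.lift fun k => ⟨Pi.single k 1, Pi.single k 1⟩

/-- The Magnus homomorphism of the free metabelian group, determined by
`x_k ↦ (x_k, t_k; 0, 1)`. -/
noncomputable def magnus (n : ℕ) : FreeMetabelian n →* MagnusGroup n :=
  QuotientGroup.lift _ (magnusFree n) <| by
    intro w hw
    have h := map_derivedSeries_le_derivedSeries (magnusFree n) 2
      (Subgroup.mem_map_of_mem (magnusFree n) hw)
    rw [MagnusGroup.derivedSeries_two, Subgroup.mem_bot] at h
    exact h

/-- The Magnus matrix `(a_{k,l})` of an automorphism `α` of the free metabelian group: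
`α` sends the `k`-th generator to `(x^g, a_{k,1} t_1 + … + a_{k,n} t_n; 0, 1)`
(with `x^g = x_k` if `α` lies in `IA(Φ_n)`). -/
noncomputable def magnusMatrix {n : ℕ} (α : MulAut (FreeMetabelian n)) :
    Matrix (Fin n) (Fin n) (LaurentRing n) :=
  Matrix.of fun k l => (magnus n (α (FreeMetabelian.gen k))).coeff l

/-- `GL_d(R, H) = ker (GL_d(R) → GL_d(R / H))`. -/
def congruenceGL (d : ℕ) {R : Type*} [CommRing R] (H : Ideal R) :
    Subgroup (Matrix.GeneralLinearGroup (Fin d) R) :=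
  (Matrix.GeneralLinearGroup.map (n := Fin d) (Ideal.Quotient.mk H)).ker

/-- `GL_d(ℤ[x^{±1}], (x - 1) ℤ[x^{±1}])`. -/
noncomputable abbrev laurentCongruenceGL (d : ℕ) :
    Subgroup (Matrix.GeneralLinearGroup (Fin d) (LaurentPolynomial ℤ)) :=
  congruenceGL d (Ideal.span {(LaurentPolynomial.T 1 - 1 : LaurentPolynomial ℤ)})

/-! An IA-automorphism preserves the exponent in the Magnus group, so there it acts on coefficient
rows as right multiplication by its Magnus matrix. Hence the matrix is multiplicative for
left-to-right composition (`magnusMatrix_mul`). Setting `x_j = 1` for `j ≠ i` in the fundamental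
identity `sum_magnus_coeff_mul` leaves a single term, and cancelling `x_i - 1` makes column `i`
trivial (`projLaurent_magnusMatrix_col`). The specialised matrix is block triangular, so its minor
is multiplicative. It is trivial modulo `x_i - 1` because augmentations of Fox derivatives are
exponent sums.

For the section, write `M = 1 + (1 - x_i) A`, fix `y_i`, and multiply each other `y_k` by the
commutators `[y_l, y_i]` raised to the powers `A_{kl}`. The coefficient of `[y_l, y_i]` at `t_l` is
`1 - x_i`, so the minor is `M`. The commutator subgroup is abelian, and `bracketEnd_comp` shows
directly that composition corresponds to the product of the matrices `M`. Invertible matrices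
therefore give automorphisms, and faithfulness of the Magnus representation is never used. -/

namespace MagnusGroup

/-- The endomorphism of the Magnus group that multiplies the row of coefficients by a matrix. -/
noncomputable def rightMul {n : ℕ} (A : Matrix (Fin n) (Fin n) (LaurentRing n)) :
    MagnusGroup n →* MagnusGroup n where
  toFun a := ⟨a.exponent, Matrix.vecMul a.coeff A⟩
  map_one' := by ext1 <;> simp
  map_mul' a b := by
    ext1
    · simp
    · simp [Matrix.add_vecMul, Matrix.smul_vecMul]

@[simp] theorem rightMul_exponent {n : ℕ} (A : Matrix (Fin n) (Fin n) (LaurentRing n))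
    (a : MagnusGroup n) : (rightMul A a).exponent = a.exponent := rfl

@[simp] theorem rightMul_coeff {n : ℕ} (A : Matrix (Fin n) (Fin n) (LaurentRing n))
    (a : MagnusGroup n) : (rightMul A a).coeff = Matrix.vecMul a.coeff A := rfl

/-- The ring homomorphism `R_n → ℤ` with `x_k ↦ 1`. -/
noncomputable def augmentation (n : ℕ) : LaurentRing n →+* ℤ :=
  (AddMonoidAlgebra.lift ℤ ℤ (Fin n → ℤ) 1).toRingHom

theorem augmentation_single {n : ℕ} (g : Fin n → ℤ) (a : ℤ) :
    augmentation n (AddMonoidAlgebra.single g a) = a := by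
  simp [augmentation, AddMonoidAlgebra.lift_single]

end MagnusGroup

/-! ### Fox calculus and the Magnus matrix of an IA-automorphism. -/

open MagnusGroup

theorem FreeMetabelian.hom_ext {n : ℕ} {M : Type*} [Monoid M] {f g : FreeMetabelian n →* M}
    (h : ∀ k, f (FreeMetabelian.gen k) = g (FreeMetabelian.gen k)) : f = g :=
  QuotientGroup.monoidHom_ext _ (FreeGroup.ext_hom _ _ h)

@[simp] theorem magnus_gen {n : ℕ} (k : Fin n) :
    magnus n (FreeMetabelian.gen k) = ⟨Pi.single k 1, Pi.single k 1⟩ :=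
  FreeGroup.lift_apply_of

/-- The fundamental identity of the free differential calculus. -/
theorem sum_magnus_coeff_mul {n : ℕ} (w : FreeMetabelian n) :
    ∑ l, (magnus n w).coeff l *
        ((AddMonoidAlgebra.single (Pi.single l 1) 1 : LaurentRing n) - 1) =
      (AddMonoidAlgebra.single (magnus n w).exponent 1 : LaurentRing n) - 1 := by
  let d : Fin n → LaurentRing n := fun l => AddMonoidAlgebra.single (Pi.single l 1) 1 - 1
  -- The identity cuts out a subgroup, so it need only be checked on generators.
  let S : Subgroup (MagnusGroup n) :=
    { carrier := {a | ∑ l, a.coeff l * d l = AddMonoidAlgebra.single a.exponent 1 - 1}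
      one_mem' := by simp [AddMonoidAlgebra.one_def]
      mul_mem' := by
        intro a b ha hb
        simp only [Set.mem_ofPred_eq, mul_coeff, mul_exponent, Pi.add_apply, Pi.smul_apply,
          smul_eq_mul, add_mul, Finset.sum_add_distrib, mul_assoc, ← Finset.mul_sum] at *
        rw [ha, hb, mul_sub, AddMonoidAlgebra.single_mul_single]
        simp
      inv_mem' := by
        intro a ha
        simp only [Set.mem_ofPred_eq, inv_coeff, inv_exponent, Pi.neg_apply, Pi.smul_apply,
          smul_eq_mul, neg_mul, Finset.sum_neg_distrib, mul_assoc, ← Finset.mul_sum] at *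
        rw [ha, mul_sub, AddMonoidAlgebra.single_mul_single]
        simp [AddMonoidAlgebra.one_def] }
  have key : ∀ v : FreeGroup (Fin n), magnusFree n v ∈ S := by
    intro v
    have hr : (magnusFree n).range ≤ S := by
      refine FreeGroup.range_lift_le ?_
      rintro _ ⟨k, rfl⟩
      change ∑ l, (Pi.single k (1 : LaurentRing n) : Fin n → LaurentRing n) l * d l = d k
      rw [Finset.sum_eq_single k] <;> simp +contextual
    exact hr ⟨v, rfl⟩
  induction w using QuotientGroup.induction_on with
  | H v => exact key v

/-- The exponent sums of a word are the augmentations of its Fox derivatives. -/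
theorem augmentation_magnus_coeff {n : ℕ} (w : FreeMetabelian n) (l : Fin n) :
    augmentation n ((magnus n w).coeff l) = (magnus n w).exponent l := by
  -- Augmentation sends the twisting monomial to 1, so both sides become homomorphisms to `ℤ`.
  let f : MagnusGroup n →* Multiplicative ℤ :=
    { toFun := fun a => Multiplicative.ofAdd (augmentation n (a.coeff l))
      map_one' := by simp
      map_mul' := by
        intro a b
        simp [augmentation_single] }
  let g : MagnusGroup n →* Multiplicative ℤ :=
    { toFun := fun a => Multiplicative.ofAdd (a.exponent l)
      map_one' := by simp
      map_mul' := by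
        intro a b
        simp }
  have h : f.comp (magnus n) = g.comp (magnus n) := by
    refine FreeMetabelian.hom_ext fun k => ?_
    simp only [f, g, MonoidHom.comp_apply, MonoidHom.coe_mk, OneHom.coe_mk, magnus_gen]
    by_cases hk : l = k
    · subst hk; simp
    · simp [hk]
  exact Multiplicative.ofAdd.injective (DFunLike.congr_fun h w)

/-- The exponent factors through the abelianization, where `β` acts trivially. -/
theorem exponent_magnus_of_mem_IA {n : ℕ} {β : MulAut (FreeMetabelian n)} (hβ : β ∈ IA n)
    (w : FreeMetabelian n) : (magnus n (β w)).exponent = (magnus n w).exponent := by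
  have h1 : Abelianization.of (β w) = Abelianization.of w := by
    have h2 : (autToAutAbelianization (FreeMetabelian n) β) (Abelianization.of w) =
        Abelianization.of w := by
      rw [show autToAutAbelianization (FreeMetabelian n) β = 1 from hβ]
      rfl
    rw [← h2]
    rfl
  have h3 := congrArg (Abelianization.lift ((exponentHom n).comp (magnus n))) h1
  simpa [exponentHom] using h3

theorem magnusMatrix_one (n : ℕ) : magnusMatrix (1 : MulAut (FreeMetabelian n)) = 1 := by
  ext1 k l
  simp [magnusMatrix, Matrix.one_apply, Pi.single_apply, eq_comm]

/-- Two homomorphisms are compared on generators. Membership in `IA` gives equality of exponents, so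
no twist of the coefficient ring appears. -/
theorem magnus_apply_of_mem_IA {n : ℕ} {β : MulAut (FreeMetabelian n)} (hβ : β ∈ IA n)
    (w : FreeMetabelian n) : magnus n (β w) = rightMul (magnusMatrix β) (magnus n w) := by
  have h : (magnus n).comp β.toMonoidHom = (rightMul (magnusMatrix β)).comp (magnus n) := by
    refine FreeMetabelian.hom_ext fun k => ?_
    ext1
    · simp [exponent_magnus_of_mem_IA hβ]
    · simp only [MonoidHom.comp_apply, rightMul_coeff, magnus_gen, Matrix.single_one_vecMul]
      rfl
  exact DFunLike.congr_fun h w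

theorem magnusMatrix_mul {n : ℕ} (α : MulAut (FreeMetabelian n)) {β : MulAut (FreeMetabelian n)}
    (hβ : β ∈ IA n) : magnusMatrix (β * α) = magnusMatrix α * magnusMatrix β := by
  ext1 k l
  simp only [magnusMatrix, MulAut.mul_apply, Matrix.of_apply]
  rw [magnus_apply_of_mem_IA hβ]
  rfl

/-! ### The retraction onto the congruence subgroup. -/

theorem projLaurent_single {n : ℕ} (i : Fin n) (g : Fin n → ℤ) (a : ℤ) :
    projLaurent i (AddMonoidAlgebra.single g a) = AddMonoidAlgebra.single (g i) a := by
  simp [projLaurent, AddMonoidAlgebra.mapDomain_single]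

theorem LaurentPolynomial.T_one_sub_one_ne_zero :
    (LaurentPolynomial.T 1 - 1 : LaurentPolynomial ℤ) ≠ 0 := by
  rw [sub_ne_zero, ← LaurentPolynomial.T_zero]
  intro h
  have := congrArg (fun p : LaurentPolynomial ℤ => p.coeff 1) h
  rw [LaurentPolynomial.T_apply, LaurentPolynomial.T_apply] at this
  simp at this

/-- Setting `x_j = 1` for `j ≠ i` turns the `i`-th column of a Magnus matrix into that of the
identity matrix. -/
theorem projLaurent_magnusMatrix_col {n : ℕ} (i k : Fin n) {α : MulAut (FreeMetabelian n)}
    (hα : α ∈ IA n) : projLaurent i (magnusMatrix α k i) = if k = i then 1 else 0 := by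
  have h := congrArg (projLaurent i) (sum_magnus_coeff_mul (α (FreeMetabelian.gen k)))
  simp only [map_sum, map_mul, map_sub, projLaurent_single, map_one,
    exponent_magnus_of_mem_IA hα, magnus_gen] at h
  have h1 : (AddMonoidAlgebra.single (0 : ℤ) (1 : ℤ) : LaurentPolynomial ℤ) = 1 := rfl
  have h2 : (AddMonoidAlgebra.single (1 : ℤ) (1 : ℤ) : LaurentPolynomial ℤ) =
    LaurentPolynomial.T 1 := rfl
  -- For `l ≠ i` the factor `x_l - 1` specialises to 0.
  rw [Finset.sum_eq_single i (fun l _ hl => by simp [hl.symm, h1]) (by simp)] at h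
  refine mul_right_cancel₀ LaurentPolynomial.T_one_sub_one_ne_zero (h2 ▸ ?_)
  rw [Pi.single_eq_same] at h
  refine h.trans ?_
  split_ifs with hk
  · subst hk; simp
  · simp [Ne.symm hk, h1]

/-- The minor of the Magnus matrix, with `x_j = 1` for `j ≠ i`. -/
noncomputable def magnusMinor {n : ℕ} (i : Fin (n + 1)) (α : MulAut (FreeMetabelian (n + 1))) :
    Matrix (Fin n) (Fin n) (LaurentPolynomial ℤ) :=
  ((magnusMatrix α).submatrix i.succAbove i.succAbove).map (projLaurent i)

theorem magnusMinor_one {n : ℕ} (i : Fin (n + 1)) : magnusMinor i 1 = 1 := by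
  rw [magnusMinor, magnusMatrix_one, Matrix.submatrix_one _ Fin.succAbove_right_injective]
  exact Matrix.map_one _ (map_zero _) (map_one _)

/-- The summand through index `i`, which the minors omit, vanishes because column `i` of the
specialised matrix of `α` is zero off the diagonal. -/
theorem magnusMinor_mul {n : ℕ} (i : Fin (n + 1)) {α β : MulAut (FreeMetabelian (n + 1))}
    (hα : α ∈ IA (n + 1)) (hβ : β ∈ IA (n + 1)) :
    magnusMinor i (β * α) = magnusMinor i α * magnusMinor i β := by
  ext1 k l
  simp only [magnusMinor, magnusMatrix_mul α hβ, Matrix.map_apply, Matrix.submatrix_apply,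
    Matrix.mul_apply, map_sum, map_mul]
  rw [Fin.sum_univ_succAbove _ i, projLaurent_magnusMatrix_col i _ hα]
  simp

/-- Every power of `x_i` becomes 1 modulo `x_i - 1`, so there the projection agrees with the
augmentation. -/
theorem projLaurent_sub_augmentation_mem {n : ℕ} (i : Fin n) (a : LaurentRing n) :
    projLaurent i a - (augmentation n a : LaurentPolynomial ℤ) ∈
      Ideal.span {(LaurentPolynomial.T 1 - 1 : LaurentPolynomial ℤ)} := by
  let q := Ideal.Quotient.mk (Ideal.span {(LaurentPolynomial.T 1 - 1 : LaurentPolynomial ℤ)})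
  have hq : q (LaurentPolynomial.T 1) = 1 := by
    rw [← map_one q]
    exact Ideal.Quotient.eq.mpr (Ideal.subset_span rfl)
  have hT : ∀ m : ℤ, q (LaurentPolynomial.T m) = 1 := by
    have h : q.toMonoidHom.comp
        (AddMonoidAlgebra.of ℤ ℤ : Multiplicative ℤ →* LaurentPolynomial ℤ) = 1 := by
      ext
      exact hq
    exact fun m => DFunLike.congr_fun h (Multiplicative.ofAdd m)
  rw [← Ideal.Quotient.eq]
  have h : (q.comp (projLaurent i)).toAddMonoidHom =
      ((q.comp (Int.castRingHom _)).comp (augmentation n)).toAddMonoidHom := by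
    ext g
    have := hT (g i)
    simpa [projLaurent_single, augmentation_single] using this
  exact DFunLike.congr_fun h a

theorem augmentation_magnusMatrix {n : ℕ} {α : MulAut (FreeMetabelian n)} (hα : α ∈ IA n)
    (k l : Fin n) : augmentation n (magnusMatrix α k l) = (1 : Matrix (Fin n) (Fin n) ℤ) k l := by
  have h := augmentation_magnus_coeff (α (FreeMetabelian.gen k)) l
  rw [exponent_magnus_of_mem_IA hα] at h
  refine h.trans ?_
  simp [Matrix.one_apply, Pi.single_apply, eq_comm]

theorem mk_magnusMinor {n : ℕ} (i : Fin (n + 1)) {α : MulAut (FreeMetabelian (n + 1))}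
    (hα : α ∈ IA (n + 1)) :
    (magnusMinor i α).map (Ideal.Quotient.mk
      (Ideal.span {(LaurentPolynomial.T 1 - 1 : LaurentPolynomial ℤ)})) = 1 := by
  ext k l
  have h := projLaurent_sub_augmentation_mem i (magnusMatrix α (i.succAbove k) (i.succAbove l))
  rw [augmentation_magnusMatrix hα, ← Ideal.Quotient.eq] at h
  refine h.trans ?_
  by_cases hkl : k = l <;>
    simp [Matrix.one_apply, hkl]

/-- The homomorphism `IA(Φ_{n+1}) → GL_n(ℤ[x_i^{±1}], (x_i - 1))`. -/
noncomputable def magnusMinorHom {n : ℕ} (i : Fin (n + 1)) :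
    (IA (n + 1))ᵐᵒᵖ →* laurentCongruenceGL n :=
  (MonoidHom.toHomUnits
    ({ toFun := fun α => magnusMinor i (α.unop : MulAut (FreeMetabelian (n + 1)))
       map_one' := magnusMinor_one i
       map_mul' := fun α β => magnusMinor_mul i α.unop.2 β.unop.2 } :
      (IA (n + 1))ᵐᵒᵖ →* Matrix (Fin n) (Fin n) (LaurentPolynomial ℤ))).codRestrict _ <|
    fun α => Units.ext (mk_magnusMinor i α.unop.2)

theorem coe_magnusMinorHom {n : ℕ} (i : Fin (n + 1)) (α : (IA (n + 1))ᵐᵒᵖ) :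
    ((magnusMinorHom i α : Matrix.GeneralLinearGroup (Fin n) (LaurentPolynomial ℤ)) :
      Matrix (Fin n) (Fin n) (LaurentPolynomial ℤ)) =
      magnusMinor i (α.unop : MulAut (FreeMetabelian (n + 1))) := rfl

/-! ### The commutator subgroup as a module over Laurent polynomials. -/

theorem FreeMetabelian.derivedSeries_two (n : ℕ) : derivedSeries (FreeMetabelian n) 2 = ⊥ := by
  rw [← map_derivedSeries_eq (QuotientGroup.mk'_surjective (derivedSeries (FreeGroup (Fin n)) 2)),
    Subgroup.map_eq_bot_iff, QuotientGroup.ker_mk']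

theorem FreeMetabelian.mul_comm_of_mem_commutator {n : ℕ} {a b : FreeMetabelian n}
    (ha : a ∈ commutator (FreeMetabelian n)) (hb : b ∈ commutator (FreeMetabelian n)) :
    a * b = b * a := by
  rw [← derivedSeries_one] at ha hb
  have h := Subgroup.commutator_mem_commutator ha hb
  rw [← derivedSeries_succ, FreeMetabelian.derivedSeries_two, Subgroup.mem_bot] at h
  exact commutatorElement_eq_one_iff_mul_comm.mp h

instance FreeMetabelian.commGroupCommutator (n : ℕ) :
    CommGroup (commutator (FreeMetabelian n)) :=
  { (inferInstance : Group (commutator (FreeMetabelian n))) with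
    mul_comm := fun a b => Subtype.ext (FreeMetabelian.mul_comm_of_mem_commutator a.2 b.2) }

namespace FreeMetabelian

open scoped commutatorElement

variable {n : ℕ}

/-- The commutator subgroup of the free metabelian group, written additively. -/
abbrev Derived (n : ℕ) : Type := Additive (commutator (FreeMetabelian n))

/-- The element of the free metabelian group underlying an element of its commutator subgroup. -/
def Derived.val (d : Derived n) : FreeMetabelian n := (d.toMul : FreeMetabelian n)

theorem Derived.val_mem (d : Derived n) : d.val ∈ commutator (FreeMetabelian n) := d.toMul.2

theorem Derived.ext {d e : Derived n} (h : d.val = e.val) : d = e :=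
  Additive.toMul.injective (Subtype.ext h)

@[simp] theorem Derived.val_zero : (0 : Derived n).val = 1 := rfl
@[simp] theorem Derived.val_add (d e : Derived n) : (d + e).val = d.val * e.val := rfl
@[simp] theorem Derived.val_neg (d : Derived n) : (-d).val = d.val⁻¹ := rfl

/-- Conjugation as an action on the commutator subgroup. -/
def conjDerived (n : ℕ) : FreeMetabelian n →* AddMonoid.End (Derived n) where
  toFun t := MonoidHom.toAdditive
    (MulAut.conjNormal (H := commutator (FreeMetabelian n)) t).toMonoidHom
  map_one' := by
    refine AddMonoidHom.ext fun d => Derived.ext ?_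
    change 1 * d.val * 1⁻¹ = d.val
    simp
  map_mul' s t := by
    refine AddMonoidHom.ext fun d => Derived.ext ?_
    change s * t * d.val * (s * t)⁻¹ = s * (t * d.val * t⁻¹) * s⁻¹
    group

theorem val_conjDerived (t : FreeMetabelian n) (d : Derived n) :
    (conjDerived n t d).val = t * d.val * t⁻¹ := rfl

/-- The action of `ℤ[x^{±1}]` on the commutator subgroup with `x` acting as conjugation by `t`. -/
noncomputable def laurentAct (t : FreeMetabelian n) :
    LaurentPolynomial ℤ →+* AddMonoid.End (Derived n) :=
  (AddMonoidAlgebra.lift ℤ (AddMonoid.End (Derived n)) ℤ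
    ((conjDerived n).comp (zpowersHom _ t))).toRingHom

theorem laurentAct_single (t : FreeMetabelian n) (m : ℤ) :
    laurentAct t (AddMonoidAlgebra.single m 1) = conjDerived n (t ^ m) :=
  (AddMonoidAlgebra.lift_single _ m (1 : ℤ)).trans (one_smul ℤ _)

theorem laurentAct_T_one (t : FreeMetabelian n) :
    laurentAct t (LaurentPolynomial.T 1) = conjDerived n t := by
  exact (laurentAct_single t 1).trans (congrArg _ (zpow_one t))

theorem laurentAct_add_apply (t : FreeMetabelian n) (p q : LaurentPolynomial ℤ) (d : Derived n) :
    laurentAct t (p + q) d = laurentAct t p d + laurentAct t q d := by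
  rw [map_add]
  rfl

theorem laurentAct_mul_apply (t : FreeMetabelian n) (p q : LaurentPolynomial ℤ) (d : Derived n) :
    laurentAct t (p * q) d = laurentAct t p (laurentAct t q d) := by
  rw [map_mul]
  rfl

/-- The restriction of an endomorphism to the commutator subgroup. -/
def mapDerived (β : FreeMetabelian n →* FreeMetabelian n) : Derived n →+ Derived n :=
  MonoidHom.toAdditive ((β.comp (commutator (FreeMetabelian n)).subtype).codRestrict _ fun d => by
    have h : (commutator (FreeMetabelian n)).map β ≤ commutator (FreeMetabelian n) := by
      rw [commutator_def, Subgroup.map_commutator]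
      exact Subgroup.commutator_mono le_top le_top
    exact h ⟨d, d.2, rfl⟩)

@[simp] theorem val_mapDerived (β : FreeMetabelian n →* FreeMetabelian n) (d : Derived n) :
    (mapDerived β d).val = β d.val := rfl

/-- An endomorphism fixing `t` commutes with conjugation by powers of `t`; additivity extends this
from monomials. -/
theorem mapDerived_laurentAct {β : FreeMetabelian n →* FreeMetabelian n} {t : FreeMetabelian n}
    (ht : β t = t) (p : LaurentPolynomial ℤ) (d : Derived n) :
    mapDerived β (laurentAct t p d) = laurentAct t p (mapDerived β d) := by
  have h : ((AddMonoidHom.compHom (mapDerived β)).comp (laurentAct t).toAddMonoidHom :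
      LaurentPolynomial ℤ →+ Derived n →+ Derived n) =
      (AddMonoidHom.compHom.flip (mapDerived β)).comp (laurentAct t).toAddMonoidHom := by
    refine AddMonoidAlgebra.addHom_ext' fun m => AddMonoidHom.ext_int ?_
    refine AddMonoidHom.ext fun d => Derived.ext ?_
    change (mapDerived β (laurentAct t (AddMonoidAlgebra.single m 1) d)).val =
      (laurentAct t (AddMonoidAlgebra.single m 1) (mapDerived β d)).val
    rw [laurentAct_single, val_mapDerived, val_conjDerived, val_conjDerived]
    simp [ht]
  exact DFunLike.congr_fun (DFunLike.congr_fun h p) d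

/-- The commutator of two elements, as an element of the commutator subgroup. -/
def bracket (a b : FreeMetabelian n) : Derived n :=
  Additive.ofMul ⟨⁅a, b⁆, Subgroup.commutator_mem_commutator trivial trivial⟩

theorem val_bracket (a b : FreeMetabelian n) : (bracket a b).val = ⁅a, b⁆ := rfl

/-- From `[ua, t] = u [a, t] (t u t⁻¹)⁻¹`. This is the source of the factor `1 - x`. -/
theorem bracket_mul_left (u : Derived n) (a t : FreeMetabelian n) :
    bracket (u.val * a) t = bracket a t + laurentAct t (1 - LaurentPolynomial.T 1) u := by
  have h : bracket (u.val * a) t = u + bracket a t - conjDerived n t u :=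
    Derived.ext (by
      simp only [sub_eq_add_neg, Derived.val_add, Derived.val_neg, val_conjDerived, val_bracket,
        commutatorElement_def]
      group)
  rw [h, map_sub, map_one, laurentAct_T_one]
  change _ = bracket a t + (u - conjDerived n t u)
  abel

/-! ### Endomorphisms attached to matrices. -/

variable (i : Fin (n + 1))

/-- The product of the commutators `[y_l, y_i]^{v_l}`, `l ≠ i`, with exponents in
`ℤ[x_i^{±1}]`. -/
noncomputable def bracketSum (v : Fin n → LaurentPolynomial ℤ) : Derived (n + 1) :=
  ∑ l, laurentAct (gen i) (v l) (bracket (gen (i.succAbove l)) (gen i))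

theorem bracketSum_zero : bracketSum i (0 : Fin n → LaurentPolynomial ℤ) = 0 := by
  simp [bracketSum]

theorem bracketSum_add (v w : Fin n → LaurentPolynomial ℤ) :
    bracketSum i (v + w) = bracketSum i v + bracketSum i w := by
  simp only [bracketSum, Pi.add_apply, laurentAct_add_apply, Finset.sum_add_distrib]

theorem bracketSum_smul (p : LaurentPolynomial ℤ) (v : Fin n → LaurentPolynomial ℤ) :
    bracketSum i (p • v) = laurentAct (gen i) p (bracketSum i v) := by
  simp only [bracketSum, Pi.smul_apply, smul_eq_mul, laurentAct_mul_apply, map_sum]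

theorem bracketSum_sum {κ : Type*} (s : Finset κ) (f : κ → Fin n → LaurentPolynomial ℤ) :
    bracketSum i (∑ k ∈ s, f k) = ∑ k ∈ s, bracketSum i (f k) :=
  map_sum (⟨⟨bracketSum i, bracketSum_zero i⟩, bracketSum_add i⟩ :
    (Fin n → LaurentPolynomial ℤ) →+ Derived (n + 1)) f s

/-- The endomorphism `y_i ↦ y_i`, `y_k ↦ (∏_l [y_l, y_i]^{A_{kl}}) y_k` for `k ≠ i`. -/
noncomputable def bracketEnd (A : Matrix (Fin n) (Fin n) (LaurentPolynomial ℤ)) :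
    FreeMetabelian (n + 1) →* FreeMetabelian (n + 1) :=
  QuotientGroup.lift _
    (FreeGroup.lift (i.insertNth (gen i) fun k => (bracketSum i (A k)).val * gen (i.succAbove k)))
    (by
      intro w hw
      have h := map_derivedSeries_le_derivedSeries (FreeGroup.lift
        (i.insertNth (gen i) fun k => (bracketSum i (A k)).val * gen (i.succAbove k))) 2
        (Subgroup.mem_map_of_mem _ hw)
      rwa [derivedSeries_two, Subgroup.mem_bot] at h)

theorem bracketEnd_gen_self (A : Matrix (Fin n) (Fin n) (LaurentPolynomial ℤ)) :
    bracketEnd i A (gen i) = gen i :=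
  FreeGroup.lift_apply_of.trans (Fin.insertNth_apply_same i _ _)

theorem bracketEnd_gen_succAbove (A : Matrix (Fin n) (Fin n) (LaurentPolynomial ℤ)) (k : Fin n) :
    bracketEnd i A (gen (i.succAbove k)) = (bracketSum i (A k)).val * gen (i.succAbove k) :=
  FreeGroup.lift_apply_of.trans (Fin.insertNth_apply_succAbove i _ _ k)

/-- Since `y_i` is fixed, the endomorphism is linear over `ℤ[x_i^{±1}]`; on row vectors of exponents
it is right multiplication by `1 + (1 - x_i) A`. -/
theorem mapDerived_bracketEnd_bracketSum (A : Matrix (Fin n) (Fin n) (LaurentPolynomial ℤ))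
    (v : Fin n → LaurentPolynomial ℤ) :
    mapDerived (bracketEnd i A) (bracketSum i v) =
      bracketSum i (v + (1 - LaurentPolynomial.T 1 : LaurentPolynomial ℤ) • Matrix.vecMul v A) := by
  have h : ∀ l, mapDerived (bracketEnd i A) (bracket (gen (i.succAbove l)) (gen i)) =
      bracket (gen (i.succAbove l)) (gen i) +
        laurentAct (gen i) (1 - LaurentPolynomial.T 1) (bracketSum i (A l)) := by
    intro l
    rw [← bracket_mul_left, ← bracketEnd_gen_succAbove]
    refine Derived.ext ?_
    rw [val_mapDerived, val_bracket, val_bracket, map_commutatorElement, bracketEnd_gen_self]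
  rw [bracketSum_add, bracketSum_smul, Matrix.vecMul_eq_sum, bracketSum_sum, map_sum]
  simp only [bracketSum_smul]
  conv_lhs => rw [bracketSum, map_sum]
  conv_rhs => enter [1]; rw [bracketSum]
  rw [← Finset.sum_add_distrib]
  refine Finset.sum_congr rfl fun l _ => ?_
  rw [mapDerived_laurentAct (bracketEnd_gen_self i A), h, map_add, add_right_inj]
  rw [← laurentAct_mul_apply, ← laurentAct_mul_apply, mul_comm]

/-- The resulting matrix is the `C` with `1 + (1 - x) C = (1 + (1 - x) A)(1 + (1 - x) B)`. -/
theorem bracketEnd_comp (A B : Matrix (Fin n) (Fin n) (LaurentPolynomial ℤ)) :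
    (bracketEnd i B).comp (bracketEnd i A) =
      bracketEnd i (A + B + ((1 : LaurentPolynomial ℤ) - LaurentPolynomial.T 1) • (A * B)) := by
  refine hom_ext ((Fin.forall_iff_succAbove i).mpr ⟨?_, fun k => ?_⟩)
  · simp [bracketEnd_gen_self]
  · rw [MonoidHom.comp_apply, bracketEnd_gen_succAbove, bracketEnd_gen_succAbove, map_mul,
      bracketEnd_gen_succAbove, ← val_mapDerived, mapDerived_bracketEnd_bracketSum, ← mul_assoc,
      ← Derived.val_add, ← bracketSum_add]
    congr 3
    ext1 l
    simp only [Pi.add_apply, Pi.smul_apply, Matrix.add_apply, Matrix.smul_apply,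
      Matrix.mul_apply_eq_vecMul, smul_eq_mul]
    ring

theorem bracketEnd_zero : bracketEnd i (0 : Matrix (Fin n) (Fin n) (LaurentPolynomial ℤ)) =
    MonoidHom.id _ := by
  refine hom_ext ((Fin.forall_iff_succAbove i).mpr ⟨?_, fun k => ?_⟩)
  · simp [bracketEnd_gen_self]
  · rw [bracketEnd_gen_succAbove]
    exact (congrArg (· * _) (congrArg Derived.val (bracketSum_zero i))).trans (one_mul _)

end FreeMetabelian

/-! ### Magnus coefficients of these endomorphisms. -/

namespace FreeMetabelian

open scoped commutatorElement

variable {n : ℕ}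

theorem Derived.exponent_magnus (d : Derived n) : (magnus n d.val).exponent = 0 :=
  (Abelianization.commutator_subset_ker ((exponentHom n).comp (magnus n))) d.val_mem

/-- The coefficients of the Magnus homomorphism, as an additive map on the commutator subgroup. -/
noncomputable def magnusCoeff (n : ℕ) : Derived n →+ (Fin n → LaurentRing n) where
  toFun d := (magnus n d.val).coeff
  map_zero' := by simp
  map_add' d e := by
    simp [Derived.exponent_magnus, ← AddMonoidAlgebra.one_def]

theorem inclLaurent_single (i : Fin n) (m a : ℤ) :
    inclLaurent i (AddMonoidAlgebra.single m a) = AddMonoidAlgebra.single (Pi.single i m) a :=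
  AddMonoidAlgebra.mapDomain_single

theorem inclLaurent_T_one (i : Fin n) :
    inclLaurent i (LaurentPolynomial.T 1) = AddMonoidAlgebra.single (Pi.single i 1) 1 :=
  inclLaurent_single i 1 1

theorem projLaurent_inclLaurent (i : Fin n) (p : LaurentPolynomial ℤ) :
    projLaurent i (inclLaurent i p) = p := by
  have h : ((projLaurent i).comp (inclLaurent i)).toAddMonoidHom = AddMonoidHom.id _ := by
    refine AddMonoidAlgebra.addMonoidHom_ext fun m a => ?_
    change projLaurent i (inclLaurent i _) = _
    rw [inclLaurent_single, projLaurent_single, Pi.single_eq_same]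
    rfl
  exact DFunLike.congr_fun h p

/-- As `d` has exponent 0, the contributions of `t` and `t⁻¹` cancel. -/
theorem magnusCoeff_conjDerived (t : FreeMetabelian n) (d : Derived n) :
    magnusCoeff n (conjDerived n t d) =
      (AddMonoidAlgebra.single (magnus n t).exponent 1 : LaurentRing n) • magnusCoeff n d := by
  change (magnus n (t * d.val * t⁻¹)).coeff = _ • (magnus n d.val).coeff
  simp only [map_mul, map_inv, mul_coeff, mul_exponent, inv_coeff, Derived.exponent_magnus,
    add_zero, smul_neg, smul_smul, AddMonoidAlgebra.single_mul_single, add_neg_cancel, mul_one]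
  rw [← AddMonoidAlgebra.one_def, one_smul]
  abel

theorem magnusCoeff_laurentAct (i : Fin n) (p : LaurentPolynomial ℤ) (d : Derived n) :
    magnusCoeff n (laurentAct (gen i) p d) = inclLaurent i p • magnusCoeff n d := by
  have hexp : ∀ m : ℤ, (magnus n (gen i ^ m)).exponent = Pi.single i m := by
    intro m
    have h := map_zpow ((exponentHom n).comp (magnus n)) (gen i) m
    have h2 : ((exponentHom n).comp (magnus n)) (gen i) = Multiplicative.ofAdd (Pi.single i 1) := by
      simp [exponentHom]
    rw [h2, ← ofAdd_zsmul, ← Pi.single_zsmul] at h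
    simpa [exponentHom] using h
  let f : LaurentPolynomial ℤ →+ (Fin n → LaurentRing n) :=
    ⟨⟨fun p => magnusCoeff n (laurentAct (gen i) p d), by simp⟩, fun p q =>
      (congrArg _ (laurentAct_add_apply _ p q d)).trans (map_add _ _ _)⟩
  let g : LaurentPolynomial ℤ →+ (Fin n → LaurentRing n) :=
    ⟨⟨fun p => inclLaurent i p • magnusCoeff n d, by simp⟩, fun p q => by
      simp [add_smul]⟩
  have h : f = g := by
    refine AddMonoidAlgebra.addHom_ext' fun m => AddMonoidHom.ext_int ?_
    change magnusCoeff n (laurentAct (gen i) (AddMonoidAlgebra.single m 1) d) =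
      inclLaurent i (AddMonoidAlgebra.single m 1) • magnusCoeff n d
    rw [laurentAct_single, magnusCoeff_conjDerived, inclLaurent_single, hexp]
  exact DFunLike.congr_fun h p

variable (i : Fin (n + 1))

/-- Only columns other than `i` are computed: there `y_i` contributes nothing, while `y_k` and
`y_k⁻¹` contribute `1` and `-x_k x_i x_k⁻¹` at `t_k`. -/
theorem magnusCoeff_bracket_gen (k l : Fin n) :
    magnusCoeff (n + 1) (bracket (gen (i.succAbove k)) (gen i)) (i.succAbove l) =
      inclLaurent i ((1 - LaurentPolynomial.T 1) *
        (1 : Matrix (Fin n) (Fin n) (LaurentPolynomial ℤ)) k l) := by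
  change (magnus (n + 1) ⁅gen (i.succAbove k), gen i⁆).coeff (i.succAbove l) = _
  rw [map_mul, map_sub, map_one, inclLaurent_T_one, commutatorElement_def]
  simp only [map_mul, map_inv, magnus_gen, mul_coeff, mul_exponent, inv_coeff, Pi.add_apply,
    Pi.smul_apply, Pi.neg_apply, smul_eq_mul, Fin.succAbove_ne, ne_eq, not_false_eq_true,
    Pi.single_eq_of_ne, mul_zero, neg_zero, add_zero, mul_neg]
  by_cases hkl : k = l
  · subst hkl
    simp [AddMonoidAlgebra.single_mul_single, sub_eq_add_neg]
  · simp [hkl, Ne.symm hkl]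

theorem magnusCoeff_bracketSum (v : Fin n → LaurentPolynomial ℤ) (l : Fin n) :
    magnusCoeff (n + 1) (bracketSum i v) (i.succAbove l) =
      inclLaurent i ((1 - LaurentPolynomial.T 1) * v l) := by
  simp only [bracketSum, map_sum, Finset.sum_apply, magnusCoeff_laurentAct, Pi.smul_apply,
    magnusCoeff_bracket_gen, smul_eq_mul, ← map_mul]
  rw [← map_sum]
  congr 1
  simp [Matrix.one_apply, mul_comm]

theorem magnus_bracketEnd_coeff (A : Matrix (Fin n) (Fin n) (LaurentPolynomial ℤ)) (k l : Fin n) :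
    (magnus (n + 1) (bracketEnd i A (gen (i.succAbove k)))).coeff (i.succAbove l) =
      inclLaurent i ((1 + (1 - LaurentPolynomial.T 1 : LaurentPolynomial ℤ) • A) k l) := by
  have h := magnusCoeff_bracketSum i (A k) l
  change (magnus (n + 1) (bracketSum i (A k)).val).coeff (i.succAbove l) = _ at h
  have h1 : (1 + (1 - LaurentPolynomial.T 1 : LaurentPolynomial ℤ) • A) k l =
      (1 - LaurentPolynomial.T 1) * A k l + if k = l then 1 else 0 := by
    rw [add_comm, Matrix.add_apply, Matrix.one_apply]
    rfl
  rw [bracketEnd_gen_succAbove, map_mul, mul_coeff, Derived.exponent_magnus,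
    ← AddMonoidAlgebra.one_def, one_smul, Pi.add_apply, h, h1, map_add, magnus_gen]
  by_cases hkl : k = l
  · simp [hkl]
  · simp [hkl, Ne.symm hkl]

theorem of_bracketEnd (A : Matrix (Fin n) (Fin n) (LaurentPolynomial ℤ))
    (w : FreeMetabelian (n + 1)) :
    Abelianization.of (bracketEnd i A w) = Abelianization.of w := by
  have h : Abelianization.of.comp (bracketEnd i A) = Abelianization.of := by
    refine hom_ext ((Fin.forall_iff_succAbove i).mpr ⟨?_, fun k => ?_⟩)
    · rw [MonoidHom.comp_apply, bracketEnd_gen_self]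
    · rw [MonoidHom.comp_apply, bracketEnd_gen_succAbove, map_mul,
        show Abelianization.of (bracketSum i (A k)).val = 1 from
          (QuotientGroup.eq_one_iff _).mpr (Derived.val_mem _), one_mul]
  exact DFunLike.congr_fun h w

end FreeMetabelian

open FreeMetabelian

/-! ### Congruence matrices in the form `1 + (1 - x) A`. -/

section CongruenceRoot

variable {n : ℕ}

theorem LaurentPolynomial.one_sub_T_one_ne_zero :
    (1 - LaurentPolynomial.T 1 : LaurentPolynomial ℤ) ≠ 0 := by
  rw [← neg_sub]
  exact neg_ne_zero.mpr LaurentPolynomial.T_one_sub_one_ne_zero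

theorem exists_eq_one_add_smul (M : laurentCongruenceGL n) :
    ∃ A : Matrix (Fin n) (Fin n) (LaurentPolynomial ℤ),
      ((M : Matrix.GeneralLinearGroup (Fin n) (LaurentPolynomial ℤ)) :
        Matrix (Fin n) (Fin n) (LaurentPolynomial ℤ)) =
      1 + (1 - LaurentPolynomial.T 1 : LaurentPolynomial ℤ) • A := by
  obtain ⟨M, hM⟩ := M
  have h : ∀ k l, ∃ a, a * (LaurentPolynomial.T 1 - 1) =
      (M : Matrix (Fin n) (Fin n) (LaurentPolynomial ℤ)) k l - (1 : Matrix (Fin n) (Fin n) _) k l := by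
    intro k l
    rw [← Ideal.mem_span_singleton', ← Ideal.Quotient.eq]
    have h := congrArg (fun U : Matrix.GeneralLinearGroup (Fin n) (_ ⧸ Ideal.span _) =>
      U.val k l) (MonoidHom.mem_ker.mp hM)
    refine h.trans ?_
    by_cases hkl : k = l <;> simp [Matrix.one_apply, hkl]
  choose a ha using h
  -- The ideal is generated by `x - 1`, whereas commutators produce `1 - x`; hence the sign.
  refine ⟨-Matrix.of a, ?_⟩
  ext1 k l
  have := ha k l
  simp only [Matrix.add_apply, Matrix.smul_apply, Matrix.neg_apply, Matrix.of_apply, smul_eq_mul]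
  linear_combination -this

/-- The matrix `A` with `M = 1 + (1 - x) A`. -/
noncomputable def congruenceRoot (M : laurentCongruenceGL n) :
    Matrix (Fin n) (Fin n) (LaurentPolynomial ℤ) :=
  (exists_eq_one_add_smul M).choose

theorem coe_eq_one_add_smul_congruenceRoot (M : laurentCongruenceGL n) :
    ((M : Matrix.GeneralLinearGroup (Fin n) (LaurentPolynomial ℤ)) :
      Matrix (Fin n) (Fin n) (LaurentPolynomial ℤ)) =
      1 + (1 - LaurentPolynomial.T 1 : LaurentPolynomial ℤ) • congruenceRoot M :=
  (exists_eq_one_add_smul M).choose_spec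

/-- Cancelling the nonzero factor `1 - x` makes the chosen root unique, which turns identities
between matrices into identities between roots. -/
theorem congruenceRoot_eq {M : laurentCongruenceGL n}
    {A : Matrix (Fin n) (Fin n) (LaurentPolynomial ℤ)}
    (h : ((M : Matrix.GeneralLinearGroup (Fin n) (LaurentPolynomial ℤ)) :
      Matrix (Fin n) (Fin n) (LaurentPolynomial ℤ)) =
      1 + (1 - LaurentPolynomial.T 1 : LaurentPolynomial ℤ) • A) : congruenceRoot M = A := by
  rw [coe_eq_one_add_smul_congruenceRoot, add_right_inj] at h
  ext1 k l
  exact mul_left_cancel₀ LaurentPolynomial.one_sub_T_one_ne_zero (congrFun (congrFun h k) l)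

theorem congruenceRoot_one : congruenceRoot (1 : laurentCongruenceGL n) = 0 :=
  congruenceRoot_eq (by simp)

theorem congruenceRoot_mul (M N : laurentCongruenceGL n) :
    congruenceRoot (M * N) = congruenceRoot M + congruenceRoot N +
      (1 - LaurentPolynomial.T 1 : LaurentPolynomial ℤ) • (congruenceRoot M * congruenceRoot N) := by
  refine congruenceRoot_eq ?_
  rw [Subgroup.coe_mul, Units.val_mul, coe_eq_one_add_smul_congruenceRoot M,
    coe_eq_one_add_smul_congruenceRoot N]
  simp only [mul_add, add_mul, one_mul, mul_one, smul_add, Matrix.smul_mul, Matrix.mul_smul]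
  abel

end CongruenceRoot

/-! ### The section and the splitting. -/

section BracketAut

variable {n : ℕ} (i : Fin (n + 1))

theorem bracketEnd_congruenceRoot_mul (M N : laurentCongruenceGL n) :
    bracketEnd i (congruenceRoot (M * N)) =
      (bracketEnd i (congruenceRoot N)).comp (bracketEnd i (congruenceRoot M)) := by
  rw [bracketEnd_comp, congruenceRoot_mul]

theorem bracketEnd_congruenceRoot_one :
    bracketEnd i (congruenceRoot (1 : laurentCongruenceGL n)) = MonoidHom.id _ := by
  rw [congruenceRoot_one, bracketEnd_zero]

/-- The automorphism of the free metabelian group given by a congruence matrix. -/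
noncomputable def bracketAut (M : laurentCongruenceGL n) : MulAut (FreeMetabelian (n + 1)) :=
  MonoidHom.toMulEquiv (bracketEnd i (congruenceRoot M)) (bracketEnd i (congruenceRoot M⁻¹))
    (by rw [← bracketEnd_congruenceRoot_mul, mul_inv_cancel, bracketEnd_congruenceRoot_one])
    (by rw [← bracketEnd_congruenceRoot_mul, inv_mul_cancel, bracketEnd_congruenceRoot_one])

theorem bracketAut_mem_IA (M : laurentCongruenceGL n) : bracketAut i M ∈ IA (n + 1) := by
  refine MonoidHom.mem_ker.mpr (MulEquiv.ext fun x => ?_)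
  induction x using QuotientGroup.induction_on with
  | H w => exact of_bracketEnd i (congruenceRoot M) w

/-- The homomorphism `GL_n(ℤ[x_i^{±1}], (x_i - 1)) → IA(Φ_{n+1})`. -/
noncomputable def bracketAutHom : laurentCongruenceGL n →* (IA (n + 1))ᵐᵒᵖ where
  toFun M := MulOpposite.op ⟨bracketAut i M, bracketAut_mem_IA i M⟩
  map_one' := MulOpposite.unop_injective <| Subtype.ext <| MulEquiv.ext fun w =>
    DFunLike.congr_fun (bracketEnd_congruenceRoot_one i) w
  map_mul' M N := MulOpposite.unop_injective <| Subtype.ext <| MulEquiv.ext fun w =>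
    DFunLike.congr_fun (bracketEnd_congruenceRoot_mul i M N) w

theorem magnusMatrix_bracketAut_row (M : laurentCongruenceGL n) :
    magnusMatrix (bracketAut i M) i = Pi.single i 1 := by
  change (magnus (n + 1) (bracketEnd i (congruenceRoot M) (gen i))).coeff = _
  rw [bracketEnd_gen_self, magnus_gen]

theorem magnusMatrix_bracketAut_minor (M : laurentCongruenceGL n) :
    (magnusMatrix (bracketAut i M)).submatrix i.succAbove i.succAbove =
      ((M : Matrix.GeneralLinearGroup (Fin n) (LaurentPolynomial ℤ)) :
        Matrix (Fin n) (Fin n) (LaurentPolynomial ℤ)).map (inclLaurent i) := by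
  ext1 k l
  rw [coe_eq_one_add_smul_congruenceRoot]
  exact magnus_bracketEnd_coeff i (congruenceRoot M) k l

theorem magnusMinorHom_comp_bracketAutHom :
    (magnusMinorHom i).comp (bracketAutHom i) = MonoidHom.id (laurentCongruenceGL n) := by
  refine MonoidHom.ext fun M => Subtype.ext (Units.ext ?_)
  rw [MonoidHom.comp_apply, coe_magnusMinorHom]
  change ((magnusMatrix (bracketAut i M)).submatrix _ _).map _ = _
  rw [magnusMatrix_bracketAut_minor]
  ext1 k l
  exact projLaurent_inclLaurent i _

end BracketAut

/-- A group with a retraction `ρ` onto a subgroup is the semidirect product of `ker ρ` and that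
subgroup. -/
def semidirectProductOfRetraction {G H : Type*} [Group G] [Group H] (ρ : G →* H) (ι : H →* G)
    (h : ρ.comp ι = MonoidHom.id H) :
    G ≃* ρ.ker ⋊[(MulAut.conjNormal (H := ρ.ker)).comp ι] H where
  toFun g := ⟨⟨g * (ι (ρ g))⁻¹, by
    have h1 := DFunLike.congr_fun h (ρ g)
    simp only [MonoidHom.comp_apply, MonoidHom.id_apply] at h1
    rw [MonoidHom.mem_ker, map_mul, map_inv, h1, mul_inv_cancel]⟩, ρ g⟩
  invFun x := x.left * ι x.right
  left_inv g := by simp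
  right_inv x := by
    have h1 := DFunLike.congr_fun h x.right
    simp only [MonoidHom.comp_apply, MonoidHom.id_apply] at h1
    have h2 : ρ x.left = 1 := x.left.2
    ext <;> simp [h1, h2]
  map_mul' a b := by
    ext
    · simp [mul_assoc]
    · simp
/-- The rank is `n + 1`, so that `i` runs over all indices of a free metabelian group of rank
at least one, and `i.succAbove` deletes the index `i`.
Automorphisms are composed from left to right (`αβ` is first `α`, then `β`), which is the
multiplication of `(IA (n + 1))ᵐᵒᵖ`: for this product the Magnus matrix is multiplicative. -/
theorem mainTheorem8 (n : ℕ) (i : Fin (n + 1)) :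
    ∃ (ρ : (IA (n + 1))ᵐᵒᵖ →* laurentCongruenceGL n)
      (ι : laurentCongruenceGL n →* (IA (n + 1))ᵐᵒᵖ),
      -- `ρ` deletes row and column `i` of the Magnus matrix and sets `x_j = 1` for `j ≠ i`
      (∀ α : (IA (n + 1))ᵐᵒᵖ,
        ((ρ α : Matrix.GeneralLinearGroup (Fin n) (LaurentPolynomial ℤ)) :
            Matrix (Fin n) (Fin n) (LaurentPolynomial ℤ)) =
          ((magnusMatrix (α.unop : MulAut (FreeMetabelian (n + 1)))).submatrix
            i.succAbove i.succAbove).map (projLaurent i)) ∧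
      Function.Surjective ρ ∧
      -- `ι M` has Magnus matrix with `i`-th row that of the identity, and complementary minor `M`
      (∀ M : laurentCongruenceGL n,
        (magnusMatrix ((ι M).unop : MulAut (FreeMetabelian (n + 1)))) i = Pi.single i 1 ∧
        (magnusMatrix ((ι M).unop : MulAut (FreeMetabelian (n + 1)))).submatrix
            i.succAbove i.succAbove =
          ((M : Matrix.GeneralLinearGroup (Fin n) (LaurentPolynomial ℤ)) :
            Matrix (Fin n) (Fin n) (LaurentPolynomial ℤ)).map (inclLaurent i)) ∧
      Function.Injective ι ∧
      ρ.comp ι = MonoidHom.id (laurentCongruenceGL n) ∧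
      -- the semidirect product, with `GL` acting on `ker ρ` by conjugation through `ι`
      ∃ e : (IA (n + 1))ᵐᵒᵖ ≃*
          ρ.ker ⋊[(MulAut.conjNormal (H := ρ.ker)).comp ι] laurentCongruenceGL n,
        ∀ (k : ρ.ker) (M : laurentCongruenceGL n),
          e ((k : (IA (n + 1))ᵐᵒᵖ) * ι M) = ⟨k, M⟩ := by
  have h := magnusMinorHom_comp_bracketAutHom i
  have hinv : Function.LeftInverse (magnusMinorHom i) (bracketAutHom i) := DFunLike.congr_fun h
  refine ⟨magnusMinorHom i, bracketAutHom i, coe_magnusMinorHom i, hinv.surjective,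
    fun M => ⟨magnusMatrix_bracketAut_row i M, magnusMatrix_bracketAut_minor i M⟩,
    hinv.injective, h, semidirectProductOfRetraction _ _ h, fun k M => ?_⟩
  -- The inverse isomorphism is by definition `(k, M) ↦ k * ι M`.
  exact (semidirectProductOfRetraction _ _ h).apply_symm_apply ⟨k, M⟩
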